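/- Let $\mathcal{H}_A=\mathbb{C}^A$ and $\mathcal{H}_B=\mathbb{C}^B$ be finite-dimensional Hilbert spaces with fixed orthonormal bases, indexed by the finite sets $A$ and $B$; the product basis is used on $\mathcal{H}_A\otimes\mathcal{H}_B$. Let $f:(0,\infty)\to\mathbb{R}$ be operator anti-monotone, i.e. for all positive definite complex matrices $C,D$ of the same (arbitrary finite) size, $C\le D$ implies $f(D)\le f(C)$ (Loewner order, functional calculus). For positive definite operators $X,Y$ on a finite-dimensional Hilbert space $\mathcal{H}_S$ with fixed orthonormal basis $\{|i\rangle\}_i$, define the optimized quantum $f$-divergence $$\widetilde{Q}_f(X\Vert Y)=\sup_{\tau>0,\ \operatorname{Tr}\tau\le 1}\widetilde{Q}_f(X\Vert Y;\tau),\qquad \widetilde{Q}_f(X\Vert Y;\tau)=\langle\varphi^X|\,f(\tau^{-1}\otimes Y^{T})\,|\varphi^X\rangle,\qquad |\varphi^X\rangle=(X^{1/2}\otimes I)\sum_i|i\rangle\otimes|i\rangle,$$ where $T$ is the transpose in the fixed basis and the supremum is taken in the extended real line. Then for all positive definite operators $X_{AB},Y_{AB}$ on $\mathcal{H}_A\otimes\mathcal{H}_B$,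 with $X_A=\operatorname{Tr}_B X_{AB}$ and $Y_A=\operatorname{Tr}_B Y_{AB}$, $$\widetilde{Q}_f(X_{AB}\Vert Y_{AB})\ \ge\ \widetilde{Q}_f(X_A\Vert Y_A).$$ -/

import Mathlib

open scoped ComplexOrder MatrixOrder Kronecker

noncomputable section

/-- `f` is operator anti-monotone on `(0, ∞)`: for all complex matrices `A ≤ B` (Loewner order), of
any size, whose spectra lie in `(0, ∞)`, one has `f(B) ≤ f(A)`. Only the values of `f` on `(0, ∞)`
matter. -/
def OperatorAntitone (f : ℝ → ℝ) : Prop :=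
  ∀ (n : ℕ) (A B : Matrix (Fin n) (Fin n) ℂ), A.PosDef → B.PosDef → A ≤ B → cfc f B ≤ cfc f A

/-- The (unnormalized) maximally entangled vector `|Γ⟩ = ∑ i, |i⟩ ⊗ |i⟩` of `ℂ^S ⊗ ℂ^S`. -/
def gammaVec (S : Type*) [DecidableEq S] : S × S → ℂ :=
  fun p => if p.1 = p.2 then 1 else 0

/-- The vector `|φ^X⟩ = (X^{1/2} ⊗ I)|Γ⟩`. -/
def phiVec {S : Type*} [Fintype S] [DecidableEq S] (X : Matrix S S ℂ) : S × S → ℂ :=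
  Matrix.mulVec (CFC.sqrt X ⊗ₖ (1 : Matrix S S ℂ)) (gammaVec S)

/-- `Q̃_f(X‖Y; τ) = ⟨φ^X| f(τ⁻¹ ⊗ Yᵀ) |φ^X⟩`. (For `τ`, `Y` positive definite the operator
`f(τ⁻¹ ⊗ Yᵀ)` is Hermitian, so that this number is real.) -/
def optFDivAt {S : Type*} [Fintype S] [DecidableEq S] (f : ℝ → ℝ) (X Y τ : Matrix S S ℂ) : ℝ :=
  (star (phiVec X) ⬝ᵥ Matrix.mulVec (cfc f (τ⁻¹ ⊗ₖ Y.transpose)) (phiVec X)).re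

/-- The optimized quantum `f`-divergence: the supremum, in the extended reals, of `Q̃_f(X‖Y; τ)`
over all positive definite `τ` with `Tr τ ≤ 1`. -/
def optFDiv {S : Type*} [Fintype S] [DecidableEq S] (f : ℝ → ℝ) (X Y : Matrix S S ℂ) : EReal :=
  ⨆ (τ : Matrix S S ℂ) (_ : τ.PosDef ∧ τ.trace.re ≤ 1), ((optFDivAt f X Y τ : ℝ) : EReal)

/-- The partial trace over the second tensor factor. -/
def partialTraceRight {A B : Type*} [Fintype B] (M : Matrix (A × B) (A × B) ℂ) : Matrix A A ℂ :=
  fun i j => ∑ b, M (i, b) (j, b)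

end

open Matrix

/-! Each `τ` on A lifts to an `ω` on AB with the same trace and at least as large a value. Put `K =
X^{1/2}(X_A^{-1/2} ⊗ 1)`, `ω = K(τ ⊗ 1)Kᴴ`, and let `V` send `u` to `(K ⊗ 1)(u ⊗ Γ_B)`. Then `V` is
an isometry carrying `φ^{X_A}` to `φ^X`, and it compresses `ω⁻¹ ⊗ Yᵀ` to `τ⁻¹ ⊗ Y_Aᵀ`. The claim is
then the operator Jensen inequality `f(Vᴴ M V) ≤ Vᴴ f(M) V`.

Jensen comes from anti-monotonicity alone: `M` lies below an operator that is block diagonal for the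
range of `V`, with block `(1 + δ) Vᴴ M V` there. The slack `δ` is removed by the scalar case of the
same inequality, which bounds `f x - f ((1 + δ) x)` by a multiple of `δ`, locally in `x`. -/

/-! ### Functional calculus of matrices -/

theorem continuousOn_spectrum_matrix {S : Type*} [Fintype S] [DecidableEq S]
    (f : ℝ → ℝ) (M : Matrix S S ℂ) : ContinuousOn f (spectrum ℝ M) :=
  Set.Finite.continuousOn (Matrix.finite_real_spectrum (A := M)) f

/-- Two matrices with a common intertwiner have intertwined functions. -/
theorem cfc_mul_of_intertwine {S T : Type*} [Fintype S] [DecidableEq S] [Fintype T]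
    [DecidableEq T] (f : ℝ → ℝ) {Q : Matrix S S ℂ} {P : Matrix T T ℂ} (V : Matrix S T ℂ)
    (hQ : Q.IsHermitian) (hP : P.IsHermitian) (h : Q * V = V * P) :
    cfc f Q * V = V * cfc f P := by
  classical
  let s : Finset ℝ := (Matrix.finite_real_spectrum (A := Q)).toFinset ∪
    (Matrix.finite_real_spectrum (A := P)).toFinset
  -- Interpolating on both spectra at once gives one polynomial serving `Q` and `P`, whatever the
  -- regularity of `f`.
  let p : Polynomial ℝ := Lagrange.interpolate s id f
  have hp : ∀ x ∈ s, p.eval x = f x := fun x hx =>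
    Lagrange.eval_interpolate_at_node (v := id) f (Set.injOn_id _) hx
  have h1 : cfc f Q = Polynomial.aeval Q p := by
    rw [← cfc_polynomial p Q hQ.isSelfAdjoint]
    exact cfc_congr fun x hx => (hp x (by simp [s, hx])).symm
  have h2 : cfc f P = Polynomial.aeval P p := by
    rw [← cfc_polynomial p P hP.isSelfAdjoint]
    exact cfc_congr fun x hx => (hp x (by simp [s, hx])).symm
  have hpow : ∀ n : ℕ, Q ^ n * V = V * P ^ n := by
    intro n
    induction n with
    | zero => simp
    | succ n ih => rw [pow_succ, Matrix.mul_assoc, h, ← Matrix.mul_assoc, ih, Matrix.mul_assoc,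
        ← pow_succ]
  rw [h1, h2, Polynomial.aeval_eq_sum_range, Polynomial.aeval_eq_sum_range, Matrix.sum_mul,
    Matrix.mul_sum]
  refine Finset.sum_congr rfl fun n _ => ?_
  rw [Matrix.smul_mul, Matrix.mul_smul, hpow]

theorem OperatorAntitone.cfc_le_cfc {f : ℝ → ℝ} (hf : OperatorAntitone f) {S : Type*} [Fintype S]
    [DecidableEq S] {M N : Matrix S S ℂ} (hM : M.PosDef) (hN : N.PosDef) (h : M ≤ N) :
    cfc f N ≤ cfc f M := by
  let e := (Fintype.equivFin S).symm
  have key : ∀ K : Matrix S S ℂ, K.IsHermitian →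
      cfc f (K.submatrix e e) = (cfc f K).submatrix e e := by
    intro K hK
    have h1 := cfc_mul_of_intertwine f ((1 : Matrix S S ℂ).submatrix e id)
      (hK.submatrix e) hK (by
        ext i j
        obtain ⟨j, rfl⟩ := e.surjective j
        simp [Matrix.mul_apply, Matrix.one_apply])
    ext i j
    simpa [Matrix.mul_apply, Matrix.one_apply] using congrFun (congrFun h1 i) (e j)
  have := hf _ (M.submatrix e e) (N.submatrix e e) (hM.submatrix e.injective)
    (hN.submatrix e.injective) (by
      rw [Matrix.le_iff] at h ⊢
      exact h.submatrix e)
  rw [key _ hM.isHermitian, key _ hN.isHermitian, Matrix.le_iff] at this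
  rw [Matrix.le_iff]
  exact (Matrix.posSemidef_submatrix_equiv e).1 this

/-! ### Operator Jensen inequality -/

theorem Matrix.mulVec_injective_of_conjTranspose_mul_self {S T : Type*} [Fintype S]
    [Fintype T] [DecidableEq T] {V : Matrix S T ℂ} (hV : Vᴴ * V = 1) :
    Function.Injective V.mulVec := by
  intro x y h
  have := congrArg (Vᴴ.mulVec) h
  simpa [Matrix.mulVec_mulVec, hV] using this

/-- A Jensen inequality for the compression by an isometry, with room to spare. -/
theorem OperatorAntitone.cfc_smul_compression_le {f : ℝ → ℝ} (hf : OperatorAntitone f)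
    {S T : Type*} [Fintype S] [DecidableEq S] [Fintype T] [DecidableEq T]
    {M : Matrix S S ℂ} (hM : M.PosDef) {V : Matrix S T ℂ} (hV : Vᴴ * V = 1)
    {δ : ℝ} (hδ : 0 < δ) :
    cfc f ((1 + δ) • (Vᴴ * M * V)) ≤ Vᴴ * cfc f M * V := by
  obtain ⟨s, hs, rfl⟩ : ∃ s : ℝ, 0 < s ∧ δ = s * s :=
    ⟨√δ, Real.sqrt_pos.2 hδ, (Real.mul_self_sqrt hδ.le).symm⟩
  set P : Matrix T T ℂ := (1 + s * s) • (Vᴴ * M * V) with hPdef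
  have hP : P.PosDef := by
    have := hM.conjTranspose_mul_mul_same
      (Matrix.mulVec_injective_of_conjTranspose_mul_self hV)
    exact this.smul (by positivity)
  set W : Matrix S S ℂ := 1 - V * Vᴴ with hW
  have hWH : Wᴴ = W := by simp [hW]
  have hWV : W * V = 0 := by simp [hW, Matrix.sub_mul, Matrix.mul_assoc, hV]
  set Q : Matrix S S ℂ := V * P * Vᴴ + (1 + s⁻¹ * s⁻¹) • (W * M * W) with hQdef
  -- The weights `s` and `s⁻¹` make the cross terms of `Z M Z` exactly minus the off-diagonal blocks
  -- of `M`.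
  set Z : Matrix S S ℂ := s • (V * Vᴴ) - s⁻¹ • W with hZ
  have hZH : Zᴴ = Z := by simp [hZ, hWH]
  have hQM : Q - M = Zᴴ * M * Z := by
    have hM' : M = (V * Vᴴ + W) * M * (V * Vᴴ + W) := by simp [hW]
    have h1 : V * P * Vᴴ = (1 + s * s) • ((V * Vᴴ) * M * (V * Vᴴ)) := by
      simp [hPdef, Matrix.mul_assoc]
    have hss : s * s⁻¹ = 1 := mul_inv_cancel₀ hs.ne'
    rw [hZH, hQdef, h1, hZ]
    nth_rewrite 3 [hM']
    generalize V * Vᴴ = E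
    simp only [Matrix.sub_mul, Matrix.mul_sub, Matrix.add_mul, Matrix.mul_add, Matrix.smul_mul,
      Matrix.mul_smul, smul_sub, smul_smul, add_smul, one_smul, hss, mul_comm s⁻¹ s]
    abel
  have hMQ : M ≤ Q := by
    rw [Matrix.le_iff, hQM]
    exact hM.posSemidef.conjTranspose_mul_mul_same Z
  have hQ : Q.PosDef := by
    have := Matrix.PosDef.posSemidef_add (Matrix.le_iff.1 hMQ) hM
    simpa using this
  have hQV : Q * V = V * P := by
    simp [hQdef, Matrix.add_mul, Matrix.mul_assoc, hV, hWV]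
  have hle := hf.cfc_le_cfc hM hQ hMQ
  have h2 := cfc_mul_of_intertwine f V hQ.isHermitian hP.isHermitian hQV
  have h3 : Vᴴ * cfc f Q * V = cfc f P := by
    rw [Matrix.mul_assoc, h2, ← Matrix.mul_assoc, hV, Matrix.one_mul]
  rw [← h3, Matrix.le_iff, ← Matrix.sub_mul, ← Matrix.mul_sub]
  exact (Matrix.le_iff.1 hle).conjTranspose_mul_mul_same V

theorem cfc_diagonal (f : ℝ → ℝ) {S : Type*} [Fintype S] [DecidableEq S] (d : S → ℝ) :
    cfc f (diagonal fun i => (d i : ℂ)) = diagonal fun i => (f (d i) : ℂ) := by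
  have hH : (diagonal fun i => (d i : ℂ)).IsHermitian := by
    ext i j; by_cases h : i = j <;> simp [diagonal, h, eq_comm]
  ext i j
  -- The `j`-th basis vector intertwines the diagonal matrix with the scalar `d j`.
  have h := cfc_mul_of_intertwine f (Q := diagonal fun i => (d i : ℂ))
    (P := algebraMap ℝ (Matrix Unit Unit ℂ) (d j))
    (Matrix.of fun k _ => if k = j then 1 else 0) hH
    (cfc_predicate_algebraMap (p := IsSelfAdjoint) (d j)) (by
      ext k u
      by_cases hk : k = j <;> simp [hk, Matrix.mul_apply, Matrix.algebraMap_matrix_apply])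
  rw [cfc_algebraMap] at h
  have h' := congrFun (congrFun h i) ()
  by_cases hk : i = j <;>
    simpa [hk, Matrix.mul_apply, Matrix.algebraMap_matrix_apply] using h'

theorem OperatorAntitone.antitoneOn {f : ℝ → ℝ} (hf : OperatorAntitone f) :
    AntitoneOn f (Set.Ioi 0) := by
  intro x hx y hy hxy
  have h := hf.cfc_le_cfc (S := Unit) (M := diagonal fun _ => (x : ℂ))
    (N := diagonal fun _ => (y : ℂ)) (PosDef.diagonal (by simpa using hx))
    (PosDef.diagonal (by simpa using hy)) (by
      rw [Matrix.le_iff, diagonal_sub, posSemidef_diagonal_iff]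
      intro _; exact_mod_cast sub_nonneg.2 hxy)
  rw [cfc_diagonal f fun _ : Unit => x, cfc_diagonal f fun _ : Unit => y, Matrix.le_iff,
    diagonal_sub, posSemidef_diagonal_iff] at h
  have := h ()
  norm_cast at this
  exact sub_nonneg.1 this

/-- Compression of `diag(a, b)` to the unit vector `(√t, √(1 - t))`. -/
theorem OperatorAntitone.apply_le_convex_combination {f : ℝ → ℝ} (hf : OperatorAntitone f)
    {a b t δ : ℝ} (ha : 0 < a) (hb : 0 < b) (ht : 0 ≤ t) (ht1 : t ≤ 1) (hδ : 0 < δ) :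
    f ((1 + δ) * (t * a + (1 - t) * b)) ≤ t * f a + (1 - t) * f b := by
  let d : Bool → ℝ := fun i => if i then a else b
  let V : Matrix Bool Unit ℂ := Matrix.of fun i _ => ((if i then √t else √(1 - t) : ℝ) : ℂ)
  have h1 : √t * √t = t := Real.mul_self_sqrt ht
  have h2 : √(1 - t) * √(1 - t) = 1 - t := Real.mul_self_sqrt (by linarith)
  have hVd : ∀ g : Bool → ℝ, Vᴴ * (diagonal fun i => (g i : ℂ)) * V =
      diagonal fun _ => ((t * g true + (1 - t) * g false : ℝ) : ℂ) := by
    intro g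
    ext i j
    have h3 : √t * g true * √t = t * g true := by linear_combination g true * h1
    have h4 : √(1 - t) * g false * √(1 - t) = (1 - t) * g false := by
      linear_combination g false * h2
    simp [V, Matrix.mul_apply, -Complex.ofReal_add, -Complex.ofReal_mul,
      -Complex.ofReal_sub, -Complex.ofReal_one]
    norm_cast
    rw [h3, h4]
  have hV : Vᴴ * V = 1 := by
    have := hVd fun _ => 1
    simpa using this
  have h := hf.cfc_smul_compression_le (M := diagonal fun i => (d i : ℂ)) (PosDef.diagonal (by
    intro i; cases i <;> simpa [d])) hV hδ
  have hsm : (1 + δ) • (diagonal fun _ : Unit => ((t * d true + (1 - t) * d false : ℝ) : ℂ)) =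
      diagonal fun _ => (((1 + δ) * (t * d true + (1 - t) * d false) : ℝ) : ℂ) := by
    ext i j; simp; ring
  rw [cfc_diagonal f d, hVd, hVd fun i => f (d i), hsm, cfc_diagonal f fun _ : Unit => _,
    Matrix.le_iff, diagonal_sub, posSemidef_diagonal_iff] at h
  have := h ()
  norm_cast at this
  simpa [d] using this

/-- A quantitative continuity estimate. Mixing `x / 2` into `(1 + δ) x` with weight `6 δ` lowers the
mean enough that multiplying it by `1 + δ` stays below `x`; to first order any weight above `4 δ`
would do. -/
theorem OperatorAntitone.apply_le_apply_mul_add {f : ℝ → ℝ} (hf : OperatorAntitone f)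
    {x δ : ℝ} (hx : 0 < x) (hδ : 0 < δ) (hδ' : 6 * δ ≤ 1) :
    f x ≤ f ((1 + δ) * x) + 6 * δ * (f (x / 2) - f (2 * x)) := by
  have hb : 0 < (1 + δ) * x := by positivity
  have h1 := hf.apply_le_convex_combination (a := x / 2) (b := (1 + δ) * x) (t := 6 * δ) (δ := δ)
    (by positivity) hb (by positivity) hδ' hδ
  have hy : 0 < (1 + δ) * (6 * δ * (x / 2) + (1 - 6 * δ) * ((1 + δ) * x)) := by
    have : 0 ≤ (1 - 6 * δ) * ((1 + δ) * x) := mul_nonneg (by linarith) hb.le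
    positivity
  have hyx : (1 + δ) * (6 * δ * (x / 2) + (1 - 6 * δ) * ((1 + δ) * x)) ≤ x := by
    have : (1 + δ) * (6 * δ * (1 / 2) + (1 - 6 * δ) * (1 + δ)) ≤ 1 := by
      nlinarith [mul_pos hδ hδ, mul_pos (mul_pos hδ hδ) hδ]
    nlinarith
  have h2 := hf.antitoneOn hy hx hyx
  have h3 := hf.antitoneOn hb (show 0 < 2 * x by positivity) (by nlinarith)
  nlinarith

/-- Operator anti-monotone functions satisfy the operator Jensen inequality for isometries. -/
theorem OperatorAntitone.cfc_compression_le {f : ℝ → ℝ} (hf : OperatorAntitone f)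
    {S T : Type*} [Fintype S] [DecidableEq S] [Fintype T] [DecidableEq T]
    {M : Matrix S S ℂ} (hM : M.PosDef) {V : Matrix S T ℂ} (hV : Vᴴ * V = 1) (v : T → ℂ) :
    (star v ⬝ᵥ cfc f (Vᴴ * M * V) *ᵥ v).re ≤ (star v ⬝ᵥ (Vᴴ * cfc f M * V) *ᵥ v).re := by
  set P := Vᴴ * M * V with hPdef
  have hP : P.PosDef := hM.conjTranspose_mul_mul_same
      (Matrix.mulVec_injective_of_conjTranspose_mul_self hV)
  have mono : ∀ {K N : Matrix T T ℂ}, K ≤ N →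
      (star v ⬝ᵥ K *ᵥ v).re ≤ (star v ⬝ᵥ N *ᵥ v).re := by
    intro K N h
    have := (Matrix.le_iff.1 h).dotProduct_mulVec_nonneg v
    rw [Matrix.sub_mulVec, dotProduct_sub, sub_nonneg] at this
    exact (Complex.le_def.1 this).1
  have hfin := Matrix.finite_real_spectrum (A := P)
  obtain ⟨C, hC⟩ : ∃ C : ℝ, ∀ x ∈ spectrum ℝ P, f (x / 2) - f (2 * x) ≤ C := by
    obtain ⟨C, hC⟩ := (hfin.image fun x => f (x / 2) - f (2 * x)).bddAbove
    exact ⟨C, fun x hx => hC ⟨x, hx, rfl⟩⟩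
  have hpos : ∀ x ∈ spectrum ℝ P, 0 < x := by
    intro x hx
    obtain ⟨i, rfl⟩ := hP.isHermitian.spectrum_real_eq_range_eigenvalues ▸ hx
    exact hP.eigenvalues_pos i
  have bound : ∀ δ : ℝ, 0 < δ → 6 * δ ≤ 1 → (star v ⬝ᵥ cfc f P *ᵥ v).re ≤
      (star v ⬝ᵥ (Vᴴ * cfc f M * V) *ᵥ v).re + 6 * δ * C * (star v ⬝ᵥ v).re := by
    intro δ hδ hδ'
    -- The spectrum is finite, so a single `C` makes the scalar estimate an operator inequality.
    have h1 : cfc f P ≤ cfc f ((1 + δ) • P) + algebraMap ℝ _ (6 * δ * C) := by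
      rw [← cfc_comp_const_mul (1 + δ) f P ((hfin.image _).continuousOn _)
        hP.isHermitian.isSelfAdjoint, ← cfc_add_const _ _ _ (continuousOn_spectrum_matrix _ P)
        hP.isHermitian.isSelfAdjoint]
      refine cfc_mono (fun x hx => ?_) (continuousOn_spectrum_matrix _ P)
        (continuousOn_spectrum_matrix _ P)
      have := hf.apply_le_apply_mul_add (hpos x hx) hδ hδ'
      have h6 : 6 * δ * (f (x / 2) - f (2 * x)) ≤ 6 * δ * C :=
        mul_le_mul_of_nonneg_left (hC x hx) (by positivity)
      linarith
    have h2 := mono (h1.trans (add_le_add_left (hf.cfc_smul_compression_le hM hV hδ) _))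
    rw [Matrix.add_mulVec, dotProduct_add, Complex.add_re, Algebra.algebraMap_eq_smul_one,
      Matrix.smul_mulVec, Matrix.one_mulVec, dotProduct_smul, Complex.smul_re,
      smul_eq_mul] at h2
    exact h2
  have hlim : Filter.Tendsto (fun δ : ℝ => (star v ⬝ᵥ (Vᴴ * cfc f M * V) *ᵥ v).re +
      6 * δ * C * (star v ⬝ᵥ v).re) (nhdsWithin 0 (Set.Ioi 0))
      (nhds ((star v ⬝ᵥ (Vᴴ * cfc f M * V) *ᵥ v).re)) := by
    have : Continuous fun δ : ℝ => (star v ⬝ᵥ (Vᴴ * cfc f M * V) *ᵥ v).re +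
      6 * δ * C * (star v ⬝ᵥ v).re := by fun_prop
    simpa using (this.tendsto 0).mono_left nhdsWithin_le_nhds
  refine ge_of_tendsto hlim ?_
  filter_upwards [Ioc_mem_nhdsGT (show (0 : ℝ) < 1 / 6 by norm_num)] with δ hδ
  exact bound δ hδ.1 (by linarith [hδ.2])

/-! ### The lifting isometry and partial traces -/

theorem phiVec_apply {S : Type*} [Fintype S] [DecidableEq S] (X : Matrix S S ℂ) (i j : S) :
    phiVec X (i, j) = CFC.sqrt X i j := by
  simp [phiVec, gammaVec, Matrix.mulVec, dotProduct, Fintype.sum_prod_type, Matrix.one_apply]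

theorem Matrix.PosDef.isUnit_cfcSqrt {S : Type*} [Fintype S] [DecidableEq S] {X : Matrix S S ℂ}
    (hX : X.PosDef) : IsUnit (CFC.sqrt X) := by
  have h := CFC.sqrt_mul_sqrt_self X (Matrix.nonneg_iff_posSemidef.2 hX.posSemidef)
  exact isUnit_of_mul_isUnit_left (h ▸ hX.isUnit)

theorem conjTranspose_cfcSqrt {S : Type*} [Fintype S] [DecidableEq S] (X : Matrix S S ℂ) :
    (CFC.sqrt X)ᴴ = CFC.sqrt X :=
  (Matrix.nonneg_iff_posSemidef.1 (CFC.sqrt_nonneg X)).isHermitian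

section PartialTrace

variable {A B : Type*} [Fintype B]

theorem partialTraceRight_mul_kronecker_one [Fintype A] [DecidableEq B]
    (M : Matrix (A × B) (A × B) ℂ) (N : Matrix A A ℂ) :
    partialTraceRight (M * (N ⊗ₖ (1 : Matrix B B ℂ))) = partialTraceRight M * N := by
  ext i j
  simp only [partialTraceRight, Matrix.mul_apply, Fintype.sum_prod_type, Matrix.kronecker_apply,
    Matrix.one_apply, mul_ite, mul_one, mul_zero, Finset.sum_ite_eq',
    Finset.mem_univ, if_true, Finset.sum_mul]
  rw [Finset.sum_comm]

theorem partialTraceRight_kronecker_one_mul [Fintype A] [DecidableEq B]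
    (M : Matrix (A × B) (A × B) ℂ) (N : Matrix A A ℂ) :
    partialTraceRight ((N ⊗ₖ (1 : Matrix B B ℂ)) * M) = N * partialTraceRight M := by
  ext i j
  simp only [partialTraceRight, Matrix.mul_apply, Fintype.sum_prod_type, Matrix.kronecker_apply,
    Matrix.one_apply, mul_ite, mul_one, mul_zero, ite_mul, zero_mul, Finset.sum_ite_eq,
    Finset.mem_univ, if_true, Finset.mul_sum]
  rw [Finset.sum_comm]

theorem trace_partialTraceRight [Fintype A] (M : Matrix (A × B) (A × B) ℂ) :
    (partialTraceRight M).trace = M.trace := by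
  simp [partialTraceRight, Matrix.trace, Fintype.sum_prod_type]

theorem Matrix.PosDef.partialTraceRight [Nonempty B]
    {M : Matrix (A × B) (A × B) ℂ} (hM : M.PosDef) : (partialTraceRight M).PosDef := by
  have h : _root_.partialTraceRight M = ∑ b, M.submatrix (fun a => (a, b)) (fun a => (a, b)) := by
    ext i j; simp [_root_.partialTraceRight, Matrix.sum_apply]
  rw [h]
  exact Matrix.posDef_sum Finset.univ_nonempty fun b _ =>
    hM.submatrix (fun _ _ h => (Prod.mk.inj h).1)

/-- The operator `|u⟩ ↦ (K ⊗ I)(|u⟩ ⊗ |Γ_B⟩)`, as a matrix. -/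
def gammaLift [DecidableEq A] (K : Matrix (A × B) (A × B) ℂ) :
    Matrix ((A × B) × (A × B)) (A × A) ℂ :=
  fun p c => if p.2.1 = c.2 then K p.1 (c.1, p.2.2) else 0

variable [Fintype A] [DecidableEq A]

theorem conjTranspose_gammaLift_mul_apply {T : Type*} (K : Matrix (A × B) (A × B) ℂ)
    (G : Matrix ((A × B) × (A × B)) T ℂ) (c c' : A) (y : T) :
    ((gammaLift K)ᴴ * G) (c, c') y = ∑ b, ∑ q, star (K q (c, b)) * G (q, (c', b)) y := by
  rw [Matrix.mul_apply, Fintype.sum_prod_type_right, Fintype.sum_prod_type_right]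
  refine Finset.sum_congr rfl fun b _ => ?_
  rw [Finset.sum_eq_single c' (fun a _ ha => by simp [gammaLift, ha]) (by simp)]
  simp [gammaLift]

theorem mul_gammaLift_apply {T : Type*} (K : Matrix (A × B) (A × B) ℂ)
    (G : Matrix T ((A × B) × (A × B)) ℂ) (d d' : A) (x : T) :
    (G * gammaLift K) x (d, d') = ∑ b, ∑ q, G x (q, (d', b)) * K q (d, b) := by
  rw [Matrix.mul_apply, Fintype.sum_prod_type_right, Fintype.sum_prod_type_right]
  refine Finset.sum_congr rfl fun b _ => ?_
  rw [Finset.sum_eq_single d' (fun a _ ha => by simp [gammaLift, ha]) (by simp)]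
  simp [gammaLift]

theorem gammaLift_isometry {K : Matrix (A × B) (A × B) ℂ}
    (h : partialTraceRight (Kᴴ * K) = 1) : (gammaLift K)ᴴ * gammaLift K = 1 := by
  ext ⟨c, c'⟩ ⟨d, d'⟩
  have hK := congrFun (congrFun h c) d
  rw [conjTranspose_gammaLift_mul_apply]
  simp only [partialTraceRight, Matrix.mul_apply, Matrix.conjTranspose_apply] at hK
  by_cases hc : c' = d'
  · simp only [gammaLift, hc, if_true, hK, Matrix.one_apply, Prod.mk.injEq, and_true]
  · simp [gammaLift, hc]

variable [DecidableEq B]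

/-- Since `Kᴴ W K` is trivial on B, pairing with `Γ_B` on both sides contracts the B indices of `Y`
into a partial trace. -/
theorem gammaLift_compression (K W Y : Matrix (A × B) (A × B) ℂ) {N : Matrix A A ℂ}
    (h : Kᴴ * W * K = N ⊗ₖ (1 : Matrix B B ℂ)) :
    (gammaLift K)ᴴ * (W ⊗ₖ Yᵀ) * gammaLift K = N ⊗ₖ (partialTraceRight Y)ᵀ := by
  ext ⟨c, c'⟩ ⟨d, d'⟩
  have hK : ∀ b b', (∑ p, (∑ q, star (K q (c, b)) * W q p) * K p (d, b')) =
      N c d * (if b = b' then 1 else 0) := by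
    intro b b'
    have := congrFun (congrFun h (c, b)) (d, b')
    simpa only [Matrix.mul_apply, Matrix.one_apply, Matrix.conjTranspose_apply,
      Matrix.kronecker_apply] using this
  have expand : ((gammaLift K)ᴴ * (W ⊗ₖ Yᵀ) * gammaLift K) (c, c') (d, d') =
      ∑ b', ∑ b, (∑ p, (∑ q, star (K q (c, b)) * W q p) * K p (d, b')) * Y (d', b') (c', b) := by
    rw [mul_gammaLift_apply]
    refine Finset.sum_congr rfl fun b' _ => ?_
    simp_rw [conjTranspose_gammaLift_mul_apply, Matrix.kronecker_apply, Matrix.transpose_apply,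
      Finset.sum_mul]
    rw [Finset.sum_comm]
    refine Finset.sum_congr rfl fun b _ => Finset.sum_congr rfl fun p _ =>
      Finset.sum_congr rfl fun q _ => ?_
    ring
  rw [expand]
  simp only [hK]
  simp [partialTraceRight, Finset.mul_sum]

/-- Rests on `Γ_{AB} = Γ_A ⊗ Γ_B`, up to reordering the factors. -/
theorem gammaLift_mulVec_phiVec {X Z : Matrix (A × B) (A × B) ℂ} {Y : Matrix A A ℂ}
    (h : Z * (CFC.sqrt Y ⊗ₖ (1 : Matrix B B ℂ)) = CFC.sqrt X) :
    gammaLift Z *ᵥ phiVec Y = phiVec X := by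
  ext ⟨p, a, b⟩
  rw [phiVec_apply, ← h]
  simp [Matrix.mulVec, dotProduct, Fintype.sum_prod_type, phiVec_apply, gammaLift,
    Matrix.mul_apply, Matrix.one_apply]

end PartialTrace

/-- Each value of the variational problem for the marginals is dominated by a value of the
variational problem for the joint operators. -/
theorem OperatorAntitone.exists_optFDivAt_le {A B : Type*} [Fintype A] [DecidableEq A]
    [Fintype B] [DecidableEq B] [Nonempty B] {f : ℝ → ℝ} (hf : OperatorAntitone f)
    {X Y : Matrix (A × B) (A × B) ℂ} (hX : X.PosDef) (hY : Y.PosDef)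
    {τ : Matrix A A ℂ} (hτ : τ.PosDef) :
    ∃ ω : Matrix (A × B) (A × B) ℂ, ω.PosDef ∧ ω.trace = τ.trace ∧
      optFDivAt f (partialTraceRight X) (partialTraceRight Y) τ ≤ optFDivAt f X Y ω := by
  have hXA := hX.partialTraceRight
  set XA := partialTraceRight X with hXAdef
  set R := CFC.sqrt X with hR
  set r := CFC.sqrt XA with hr
  have hRR : R * R = X := CFC.sqrt_mul_sqrt_self X (Matrix.nonneg_iff_posSemidef.2 hX.posSemidef)
  have hrr : r * r = XA :=
    CFC.sqrt_mul_sqrt_self XA (Matrix.nonneg_iff_posSemidef.2 hXA.posSemidef)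
  have hRH : Rᴴ = R := conjTranspose_cfcSqrt X
  have hrH : rᴴ = r := conjTranspose_cfcSqrt XA
  have hru : IsUnit r.det := (Matrix.isUnit_iff_isUnit_det _).1 hXA.isUnit_cfcSqrt
  have hriH : (r⁻¹)ᴴ = r⁻¹ := by rw [Matrix.conjTranspose_nonsing_inv, hrH]
  have hri : r⁻¹ * r = 1 := Matrix.nonsing_inv_mul _ hru
  have hri' : r * r⁻¹ = 1 := Matrix.mul_nonsing_inv _ hru
  set K : Matrix (A × B) (A × B) ℂ := R * (r⁻¹ ⊗ₖ (1 : Matrix B B ℂ)) with hK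
  have hKr : K * (r ⊗ₖ (1 : Matrix B B ℂ)) = R := by
    rw [hK, Matrix.mul_assoc, ← Matrix.mul_kronecker_mul, hri, Matrix.one_mul,
      Matrix.one_kronecker_one, Matrix.mul_one]
  have hKK : Kᴴ * K = (r⁻¹ ⊗ₖ (1 : Matrix B B ℂ)) * X * (r⁻¹ ⊗ₖ (1 : Matrix B B ℂ)) := by
    rw [hK, Matrix.conjTranspose_mul, Matrix.conjTranspose_kronecker, hriH, hRH,
      Matrix.conjTranspose_one, ← hRR]
    simp only [Matrix.mul_assoc]
  have hKpt : partialTraceRight (Kᴴ * K) = 1 := by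
    rw [hKK, partialTraceRight_mul_kronecker_one, partialTraceRight_kronecker_one_mul, ← hXAdef,
      ← hrr, ← Matrix.mul_assoc, hri, Matrix.one_mul, hri']
  have hKu : IsUnit K := by
    refine hX.isUnit_cfcSqrt.mul ?_
    exact IsUnit.of_mul_eq_one (r ⊗ₖ (1 : Matrix B B ℂ)) (by
      rw [← Matrix.mul_kronecker_mul, hri, Matrix.one_mul, Matrix.one_kronecker_one])
  have hKdet : IsUnit K.det := (Matrix.isUnit_iff_isUnit_det _).1 hKu
  have hKHdet : IsUnit (Kᴴ).det := by rw [Matrix.det_conjTranspose]; exact hKdet.star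
  have hτ1 : (τ ⊗ₖ (1 : Matrix B B ℂ)).PosDef := hτ.kronecker Matrix.PosDef.one
  -- Chosen so that `Kᴴ ω⁻¹ K = τ⁻¹ ⊗ 1`; the trace is kept because `Tr_B(Kᴴ K) = 1`.
  set ω : Matrix (A × B) (A × B) ℂ := K * (τ ⊗ₖ (1 : Matrix B B ℂ)) * Kᴴ with hω
  have hωP : ω.PosDef := by
    have := hτ1.conjTranspose_mul_mul_same (B := Kᴴ)
      (Matrix.mulVec_injective_of_isUnit ((Matrix.isUnit_iff_isUnit_det _).2 hKHdet))
    rwa [Matrix.conjTranspose_conjTranspose] at this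
  have hωtr : ω.trace = τ.trace := by
    rw [hω, Matrix.trace_mul_cycle, ← trace_partialTraceRight,
      partialTraceRight_mul_kronecker_one, hKpt, Matrix.one_mul]
  have hωinv : Kᴴ * ω⁻¹ * K = τ⁻¹ ⊗ₖ (1 : Matrix B B ℂ) := by
    rw [hω, Matrix.mul_inv_rev, Matrix.mul_inv_rev, Matrix.inv_kronecker, inv_one]
    simp only [Matrix.mul_assoc, Matrix.nonsing_inv_mul _ hKdet, Matrix.mul_one]
    rw [← Matrix.mul_assoc, Matrix.mul_nonsing_inv _ hKHdet, Matrix.one_mul]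
  refine ⟨ω, hωP, hωtr, ?_⟩
  have hM : (ω⁻¹ ⊗ₖ Yᵀ).PosDef := hωP.inv.kronecker hY.transpose
  have h := hf.cfc_compression_le hM (gammaLift_isometry hKpt) (phiVec XA)
  rw [gammaLift_compression K ω⁻¹ Y hωinv] at h
  refine h.trans_eq ?_
  rw [optFDivAt, ← gammaLift_mulVec_phiVec hKr, Matrix.star_mulVec, Matrix.mulVec_mulVec,
    ← Matrix.dotProduct_mulVec, Matrix.mulVec_mulVec, Matrix.mul_assoc]

theorem partialTraceRight_of_isEmpty {A B : Type*} [Fintype B] [IsEmpty B]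
    (M : Matrix (A × B) (A × B) ℂ) : partialTraceRight M = 0 := by
  ext i j; simp [partialTraceRight]

theorem optFDivAt_zero_left {S : Type*} [Fintype S] [DecidableEq S] (f : ℝ → ℝ)
    (Y τ : Matrix S S ℂ) : optFDivAt f 0 Y τ = 0 := by
  have : phiVec (0 : Matrix S S ℂ) = 0 := by
    ext ⟨i, j⟩
    rw [phiVec_apply, CFC.sqrt_zero]
    rfl
  simp [optFDivAt, this]

/-- Monotonicity of the optimized quantum `f`-divergence under partial trace. -/
theorem theorem1 {A B : Type*} [Fintype A] [DecidableEq A] [Fintype B] [DecidableEq B]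
    (f : ℝ → ℝ) (hf : OperatorAntitone f)
    (X Y : Matrix (A × B) (A × B) ℂ) (hX : X.PosDef) (hY : Y.PosDef) :
    optFDiv f (partialTraceRight X) (partialTraceRight Y) ≤ optFDiv f X Y := by
  -- For empty `B` the marginal `X_A` is `0` and may fail to be invertible, but both divergences are
  -- built from zero vectors; `1` is admissible since its trace is `0`.
  rcases isEmpty_or_nonempty B with hB | hB
  · refine iSup₂_le fun τ _ => ?_
    refine le_iSup₂_of_le 1 ⟨Matrix.PosDef.one, by simp⟩ ?_
    rw [partialTraceRight_of_isEmpty X, Subsingleton.elim X 0, optFDivAt_zero_left,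
      optFDivAt_zero_left]
  · refine iSup₂_le fun τ hτ => ?_
    obtain ⟨ω, hω, htr, hle⟩ := hf.exists_optFDivAt_le hX hY hτ.1
    exact le_iSup₂_of_le ω ⟨hω, htr ▸ hτ.2⟩ (EReal.coe_le_coe_iff.2 hle)
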